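/- Let $K$ be an algebraic function field of one variable whose field of constants is a finite field $\mathbb{F}_q$ (so $K$ is a finite extension of a rational function field $\mathbb{F}_q(x)$, and $\mathbb{F}_q$ is algebraically closed in $K$). Let $\infty$ be a place of $K$, let $A$ be the ring of all elements of $K$ that are integral outside $\infty$, i.e. that lie in the valuation ring of every place of $K$ other than $\infty$, and let $G=GL_2(A)$, acting on the projective line $\mathbb{P}_1(K)$ by Möbius transformations. For a finite index subgroup $H$ of $G$, let $\mathrm{Cusp}(H)=H\backslash\mathbb{P}_1(K)$ be its set of cusps, and let $c(H)=|\mathrm{Cusp}(H)|$. Then, for every automorphism $\sigma$ of the group $G$ and every finite index subgroup $H$ of $G$, the set $\mathrm{Cusp}(H)$ is finite and $$c(\sigma(H))=c(H).$$ -/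

import Mathlib

open scoped LinearAlgebra.Projectivization RatFunc MatrixGroups

namespace DrinfeldModular

/-- A place of the function field `K` with field of constants `F`, given by its valuation ring:
a valuation ring `O` of `K` with `F ⊆ O ≠ K`. -/
structure Place (F K : Type*) [Field F] [Field K] [Algebra F K] where
  /-- The valuation ring of the place. -/
  ring : ValuationSubring K
  algebraMap_mem : ∀ a : F, algebraMap F K a ∈ ring
  ne_top : ring ≠ ⊤

/-- The ring `A` of all elements of `K` that are integral outside the place `v`
(that is, regular at every place of `K` other than `v`). -/
def integralOutside {F K : Type*} [Field F] [Field K] [Algebra F K] (v : Place F K) :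
    Subring K :=
  ⨅ (P : Place F K) (_ : P ≠ v), P.ring.toSubring

/-- The Drinfeld modular group `G = GL₂(A)`. -/
abbrev ModularGroup {F K : Type*} [Field F] [Field K] [Algebra F K] (v : Place F K) : Type _ :=
  GL (Fin 2) (integralOutside v)

/-- The inclusion `GL₂(A) → GL₂(K)`. -/
def toGLK {F K : Type*} [Field F] [Field K] [Algebra F K] (v : Place F K) :
    ModularGroup v →* GL (Fin 2) K :=
  Matrix.GeneralLinearGroup.map (integralOutside v).subtype

/-- The cusps of a subgroup `H` of `GL₂(A)`: the orbits of `H` on `ℙ¹(K)`. -/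
def Cusp {F K : Type*} [Field F] [Field K] [Algebra F K] {v : Place F K}
    (H : Subgroup (ModularGroup v)) : Type _ :=
  MulAction.orbitRel.Quotient (H.map (toGLK v)) (ℙ K (Fin 2 → K))

/-- The number `c(H)` of cusps of `H`. -/
noncomputable def cuspNumber {F K : Type*} [Field F] [Field K] [Algebra F K] {v : Place F K}
    (H : Subgroup (ModularGroup v)) : ℕ :=
  Nat.card (Cusp H)

end DrinfeldModular

open Polynomial

/-! The set ℙ¹(K) with its action of G can be recovered from the abstract group G. In characteristic
p an element g ≠ 1 with g ^ p = 1 satisfies (g - 1)² = 0, so it fixes exactly one point. Every point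
is fixed by such an element, and two of them with the same fixed point commute. An automorphism σ
permutes these elements, and sending the fixed point of g to that of σ(g) is a well-defined
bijection e with e(kx) = σ(k)e(x) (`exists_equiv_projectiveLine`). It carries the orbits of H to
those of σ(H).

For finiteness, attach to a point the class of the ideal generated by integral coordinates. Points
of the same class are G-equivalent (`exists_classGroup_invariant`), so a finite class group leaves
finitely many orbits for G, hence for H.

The properties of A needed here follow from `Place.exists_unique_pole`: if t has its only pole at ∞,
then A is the integral closure of F[t]. To build t without Riemann–Roch, take a variable regular at
∞ and an element u of the inverse of the prime ideal of ∞. Its only other possible poles are those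
of the variable. Since F is finite, the pigeonhole principle gives two powers of u whose difference
becomes regular there after subtracting an integral element. -/

namespace DrinfeldModular

/-! ### Integral closure of F[X]: finiteness and class group -/

/-- A module that embeds semilinearly, along a finite ring homomorphism, into a finite module
is finite over a Noetherian ring. -/
lemma module_finite_of_injective_semilinear {R S M N : Type*} [CommRing R] [CommRing S]
    [AddCommGroup M] [AddCommGroup N] [IsNoetherianRing R] [Module S M] [Module.Finite S M]
    [Module R N] (φ : R →+* S) (hφ : φ.Finite) (ψ : N →ₛₗ[φ] M) (hψ : Function.Injective ψ) :
    Module.Finite R N := by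
  let := φ.toAlgebra
  have : Module.Finite R S := hφ
  let : Module R M := Module.compHom M φ
  have : IsScalarTower R S M := ⟨fun r s m => by
    rw [Algebra.smul_def, mul_smul]; rfl⟩
  have : Module.Finite R M := Module.Finite.trans S M
  let ψ' : N →ₗ[R] M :=
    { toFun := ψ
      map_add' := map_add ψ
      map_smul' := fun r n => ψ.map_smulₛₗ r n }
  exact Module.Finite.of_injective ψ' hψ

/-- The Frobenius of `F[X]`, `F` a finite field, is finite. -/
lemma iterateFrobenius_polynomial_finite (F : Type*) [Field F] [Finite F] (p : ℕ) [ExpChar F[X] p]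
    (n : ℕ) : (iterateFrobenius F[X] p n).Finite := by
  rw [RingHom.finite_iff_isIntegral_and_finiteType]
  constructor
  · intro a
    -- Each a is a root of T ^ (p ^ n) - a ^ (p ^ n), whose constant term is a Frobenius image.
    refine ⟨X ^ (p ^ n) - C a, monic_X_pow_sub_C _ (pow_ne_zero _ (expChar_pos F[X] p).ne'), ?_⟩
    simp [iterateFrobenius_def]
  · have : Module.Finite ℤ F := Module.Finite.of_finite
    have : Algebra.FiniteType ℤ F[X] := Algebra.FiniteType.trans (S := F) inferInstance inferInstance
    refine RingHom.FiniteType.of_comp_finiteType (f := algebraMap ℤ F[X]) ?_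
    have : (iterateFrobenius F[X] p n).comp (algebraMap ℤ F[X]) = algebraMap ℤ F[X] :=
      RingHom.ext_int _ _
    rw [this]
    exact RingHom.finiteType_algebraMap.2 inferInstance

theorem integralClosure_polynomial_isFractionRing (F K : Type*) [Field F] [Field K] [Algebra F[X] K]
    [FaithfulSMul F[X] K] [Algebra.IsAlgebraic F[X] K] :
    IsFractionRing (integralClosure F[X] K) K :=
  integralClosure.isFractionRing_of_algebraic fun _ h =>
    (map_eq_zero_iff _ (FaithfulSMul.algebraMap_injective F[X] K)).1 h

section integralClosure

variable (F K : Type*) [Field F] [Field K] [Algebra F K] [Algebra F[X] K]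
  [IsScalarTower F F[X] K] [FaithfulSMul F[X] K] [Algebra.IsAlgebraic F[X] K]
  [Algebra.EssFiniteType F K]

/-- The integral closure of `F[X]`, `F` a finite field, in a finitely generated algebraic
extension field of `F(X)` is a finite `F[X]`-module, also if the extension is inseparable. -/
theorem integralClosure_polynomial_finite [Finite F] : Module.Finite F[X] (integralClosure F[X] K) := by
  let k := FractionRing F[X]
  let : Algebra k K := FractionRing.liftAlgebra F[X] K
  have : IsScalarTower F[X] k K := inferInstance
  have : IsScalarTower F k K := IsScalarTower.of_algebraMap_eq fun x => by
    rw [IsScalarTower.algebraMap_apply F F[X] K, IsScalarTower.algebraMap_apply F[X] k K,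
      IsScalarTower.algebraMap_apply F F[X] k]
  have : Algebra.IsAlgebraic k K := (IsFractionRing.comap_isAlgebraic_iff (A := F[X])).1 inferInstance
  have : Algebra.EssFiniteType k K := Algebra.EssFiniteType.of_comp F k K
  have : FiniteDimensional k K := Algebra.finite_of_essFiniteType_of_isAlgebraic
  -- K/E is purely inseparable of finite exponent n, so a ↦ a ^ p ^ n maps K injectively into E. It
  -- is semilinear along Frobenius, which reduces the claim to the separable extension E/k.
  let E := separableClosure k K
  have : IsScalarTower F[X] E K := IsScalarTower.of_algebraMap_eq fun x => by
    rw [IsScalarTower.algebraMap_apply F[X] k K, IsScalarTower.algebraMap_apply F[X] k E]; rfl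
  obtain ⟨p, hp⟩ := ExpChar.exists F
  have : ExpChar K p := expChar_of_injective_algebraMap (algebraMap F K).injective p
  have : ExpChar F[X] p := expChar_of_injective_algebraMap (algebraMap F F[X]).injective p
  have : ExpChar E p := expChar_of_injective_algebraMap (algebraMap F E).injective p
  have : Module.Finite F[X] (integralClosure F[X] E) := IsIntegralClosure.finite F[X] k E _
  let n := IsPurelyInseparable.exponent E K
  have hn (a : K) : ∃ e : E, algebraMap E K e = a ^ p ^ n :=
    IsPurelyInseparable.exponent_def' E p a
  choose f hf using hn
  have hint (a : integralClosure F[X] K) : f a ∈ integralClosure F[X] E := by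
    have h : IsIntegral F[X] (algebraMap E K (f a)) := by rw [hf]; exact a.2.pow _
    exact (isIntegral_algebraMap_iff (algebraMap E K).injective).1 h
  refine module_finite_of_injective_semilinear (iterateFrobenius F[X] p n)
    (iterateFrobenius_polynomial_finite F p n) (M := integralClosure F[X] E)
    { toFun := fun a => ⟨f a, hint a⟩
      map_add' := fun a b => Subtype.ext <| (algebraMap E K).injective ?_
      map_smul' := fun r a => Subtype.ext <| (algebraMap E K).injective ?_ } fun a b hab => ?_
  · simp only [Subalgebra.coe_add, map_add, hf]
    exact add_pow_expChar_pow _ _ p n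
  · change algebraMap E K (f (r • (a : K))) =
      algebraMap E K (iterateFrobenius F[X] p n r • f (a : K))
    rw [hf, Algebra.smul_def, Algebra.smul_def, map_mul, hf, mul_pow,
      ← IsScalarTower.algebraMap_apply, iterateFrobenius_def, map_pow]
  · have h : f a = f b := congrArg Subtype.val hab
    have h2 : (a : K) ^ p ^ n = (b : K) ^ p ^ n := by rw [← hf, ← hf, h]
    exact Subtype.ext (iterateFrobenius_inj K p n h2)

theorem integralClosure_polynomial_isDedekindDomain [Finite F] :
    IsDedekindDomain (integralClosure F[X] K) := by
  have := integralClosure_polynomial_finite F K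
  have := integralClosure_polynomial_isFractionRing F K
  have : IsNoetherianRing (integralClosure F[X] K) := isNoetherian_of_tower F[X] inferInstance
  have : IsIntegrallyClosed (integralClosure F[X] K) :=
    (isIntegrallyClosed_iff_isIntegrallyClosedIn K).2 inferInstance
  exact { }

theorem integralClosure_polynomial_finite_classGroup [Finite F] :
    Finite (ClassGroup (integralClosure F[X] K)) := by
  classical
  have := Fintype.ofFinite F
  have := integralClosure_polynomial_finite F K
  have := integralClosure_polynomial_isDedekindDomain F K
  have : Algebra.IsAlgebraic F[X] (integralClosure F[X] K) := inferInstance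
  have : Module.IsTorsionFree F[X] (integralClosure F[X] K) := inferInstance
  -- Finiteness of the class number over the Euclidean domain F[X], with absolute value q ^ deg.
  exact @Finite.of_fintype _ (ClassGroup.fintypeOfAdmissibleOfAlgebraic
    (Module.Free.chooseBasis F[X] (integralClosure F[X] K)) Polynomial.cardPowDegreeIsAdmissible)

end integralClosure

/-! ### Valuation rings over a Dedekind domain -/

section DedekindCenter

variable {B K : Type*} [CommRing B] [Field K] [Algebra B K]

/-- The center on `B` of a valuation ring of `K` that contains `B`. -/
def center (O : ValuationSubring K) (hO : ∀ b : B, algebraMap B K b ∈ O) : Ideal B :=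
  (IsLocalRing.maximalIdeal O).comap ((algebraMap B K).codRestrict O.toSubring hO)

instance center_isPrime (O : ValuationSubring K) (hO : ∀ b : B, algebraMap B K b ∈ O) :
    (center O hO).IsPrime :=
  Ideal.IsPrime.comap _

lemma mem_center {O : ValuationSubring K} {hO : ∀ b : B, algebraMap B K b ∈ O} {b : B} :
    b ∈ center O hO ↔ O.valuation (algebraMap B K b) < 1 := by
  rw [center, Ideal.mem_comap]
  exact O.valuation_lt_one_iff _

lemma notMem_center {O : ValuationSubring K} {hO : ∀ b : B, algebraMap B K b ∈ O} {b : B} :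
    b ∉ center O hO ↔ O.valuation (algebraMap B K b) = 1 := by
  rw [mem_center, not_lt]
  exact ⟨fun h => le_antisymm ((O.valuation_le_one_iff _).2 (hO b)) h, fun h => h.ge⟩

variable [IsDedekindDomain B] [IsFractionRing B K]

/-- With center zero, every nonzero element of `B` would be a unit of `O`, forcing `O` to be all of
`K`. -/
lemma center_ne_bot {O : ValuationSubring K} (hO : ∀ b : B, algebraMap B K b ∈ O) (hne : O ≠ ⊤) :
    center O hO ≠ ⊥ := by
  intro h
  refine hne (eq_top_iff.2 fun a _ => ?_)
  obtain ⟨n, d, hd, rfl⟩ := IsFractionRing.div_surjective (A := B) a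
  have hd' : d ∉ center O hO := by
    rw [h]; exact nonZeroDivisors.ne_zero hd
  rw [← O.valuation_le_one_iff, map_div₀, notMem_center.1 hd', div_one, O.valuation_le_one_iff]
  exact hO n

/-- A nontrivial valuation ring containing the Dedekind domain `B` is the localization of `B` at
its center. -/
lemma mem_iff_of_center {O : ValuationSubring K} (hO : ∀ b : B, algebraMap B K b ∈ O)
    (hne : O ≠ ⊤) (a : K) :
    a ∈ O ↔ ∃ n d : B, d ∉ center O hO ∧ a * algebraMap B K d = algebraMap B K n := by
  have hinj := IsFractionRing.injective B K
  constructor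
  · intro ha
    let P := center O hO
    have : IsDiscreteValuationRing (Localization.AtPrime P) :=
      IsLocalization.AtPrime.isDiscreteValuationRing_of_dedekind_domain B
        (center_ne_bot hO hne) _
    obtain ⟨n, d, hd, rfl⟩ := IsFractionRing.div_surjective (A := B) a
    have hd0 : algebraMap B K d ≠ 0 := by
      rw [Ne, map_eq_zero_iff _ hinj]; exact nonZeroDivisors.ne_zero hd
    have hloc : Function.Injective (algebraMap B (Localization.AtPrime P)) :=
      IsLocalization.injective _ P.primeCompl_le_nonZeroDivisors
    -- In the discrete valuation ring at `P`, one of n, d divides the other. If d = n * c with c = r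
    -- / s, then n / d = s / r, and r ∈ P is excluded because n / d and r would have product s, a
    -- unit of `O`.
    obtain ⟨c, hc⟩ := ValuationRing.cond (algebraMap B (Localization.AtPrime P) n)
      (algebraMap B (Localization.AtPrime P) d)
    obtain ⟨⟨r, s⟩, hrs⟩ := IsLocalization.surj P.primeCompl c
    dsimp only at hrs
    rcases hc with hc | hc
    · have h1 : n * r = d * s := hloc (by rw [map_mul, map_mul, ← hrs, ← hc]; ring)
      by_cases hr : r ∈ P
      · exfalso
        have h2 : O.valuation (algebraMap B K n / algebraMap B K d) *
            O.valuation (algebraMap B K r) = O.valuation (algebraMap B K s) := by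
          rw [← map_mul]
          congr 1
          rw [div_mul_eq_mul_div, ← map_mul, h1, map_mul, mul_div_cancel_left₀ _ hd0]
        rw [notMem_center.1 s.2] at h2
        have h3 := (mul_le_of_le_one_left' ((O.valuation_le_one_iff _).2 ha)).trans_lt (mem_center.1 hr)
        exact h3.ne h2
      · refine ⟨s, r, hr, ?_⟩
        rw [div_mul_eq_mul_div, ← map_mul, h1, map_mul, mul_div_cancel_left₀ _ hd0]
    · have h1 : d * r = n * s := hloc (by rw [map_mul, map_mul, ← hrs, ← hc]; ring)
      refine ⟨r, s, s.2, ?_⟩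
      rw [div_mul_eq_mul_div, ← map_mul, ← h1, map_mul, mul_div_cancel_left₀ _ hd0]
  · rintro ⟨n, d, hd, h⟩
    have h1 := congrArg O.valuation h
    rw [map_mul, notMem_center.1 hd, mul_one] at h1
    rw [← O.valuation_le_one_iff, h1, O.valuation_le_one_iff]
    exact hO n

lemma eq_of_center_le {O O' : ValuationSubring K} (hO : ∀ b : B, algebraMap B K b ∈ O)
    (hO' : ∀ b : B, algebraMap B K b ∈ O') (hne : O ≠ ⊤) (hne' : O' ≠ ⊤)
    (h : center O hO ≤ center O' hO') : O = O' := by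
  have h1 : center O hO = center O' hO' :=
    (Ring.DimensionLEOne.maximalOfPrime (center_ne_bot hO hne) inferInstance).eq_of_le
      (center_isPrime O' hO').ne_top h
  ext a
  rw [mem_iff_of_center hO hne, mem_iff_of_center hO' hne', h1]

/-- For every nontrivial valuation ring `O ⊇ B` there is an element whose only pole among the
nontrivial valuation rings over `B` is `O`. -/
lemma exists_pole_of_isDedekindDomain {O : ValuationSubring K}
    (hO : ∀ b : B, algebraMap B K b ∈ O) (hne : O ≠ ⊤) :
    ∃ u : K, u ∉ Set.range (algebraMap B K) ∧ ∀ O' : ValuationSubring K, O' ≠ ⊤ → O' ≠ O →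
      (∀ b : B, algebraMap B K b ∈ O') → u ∈ O' := by
  -- Take u in P⁻¹ but not in `B`. At another center P', some a ∈ P lies outside P', and u * a ∈ B
  -- makes u regular there.
  obtain ⟨u, hu, hu1⟩ := FractionalIdeal.exists_notMem_one_of_ne_bot (K := K)
    (center_ne_bot hO hne) (center_isPrime O hO).ne_top
  rw [FractionalIdeal.mem_one_iff] at hu1
  refine ⟨u, hu1, fun O' hne' hOO' hO' => ?_⟩
  have hle : ¬ center O hO ≤ center O' hO' := fun h =>
    hOO' (eq_of_center_le hO hO' hne hne' h).symm
  obtain ⟨a, ha, ha'⟩ := SetLike.not_le_iff_exists.1 hle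
  rw [FractionalIdeal.mem_inv_iff (FractionalIdeal.coeIdeal_ne_zero.2 (center_ne_bot hO hne))] at hu
  obtain ⟨n, hn⟩ := (FractionalIdeal.mem_one_iff _).1
    (hu _ (FractionalIdeal.mem_coeIdeal_of_mem _ ha))
  exact (mem_iff_of_center hO' hne' u).2 ⟨n, a, ha', hn.symm⟩

end DedekindCenter

/-! ### Integrality over F[X] and poles of the variable -/

lemma mem_integralClosure_iff_valuationSubring {R K : Type*} [CommRing R] [Field K] [Algebra R K]
    {a : K} : a ∈ integralClosure R K ↔
      ∀ O : ValuationSubring K, (∀ r : R, algebraMap R K r ∈ O) → a ∈ O := by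
  have h := Subring.eq_iInf_of_isIntegrallyClosedIn (R := (integralClosure R K).toSubring)
  constructor
  · intro ha O hO
    let φ : R →+* O := (algebraMap R K).codRestrict O.toSubring hO
    obtain ⟨p, hp, hpa⟩ := ha
    have : IsIntegral O a := ⟨p.map φ, hp.map φ, by rw [eval₂_map]; exact hpa⟩
    obtain ⟨b, hb⟩ := (IsIntegrallyClosed.isIntegral_iff (R := O)).1 this
    exact hb ▸ b.2
  · intro ha
    rw [← Subalgebra.mem_toSubring, h, Subring.mem_iInf]
    exact fun O => ha O.1 fun r => O.2 (algebraMap_mem (integralClosure R K) r)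

section Polynomial

variable {F K : Type*} [Field F] [Field K] [Algebra F K]

lemma Place.ext_ring {v w : Place F K} (h : v.ring = w.ring) : v = w := by
  cases v; cases w; congr

instance (w : Place F K) : w.ring.valuation.IsTrivialOn F where
  eq_one a ha := by
    have h1 := (w.ring.valuation_le_one_iff _).2 (w.algebraMap_mem a)
    have h2 := (w.ring.valuation_le_one_iff _).2 (w.algebraMap_mem a⁻¹)
    refine le_antisymm h1 ?_
    rwa [map_inv₀, map_inv₀, inv_le_one₀] at h2
    rw [Valuation.pos_iff, Ne, map_eq_zero]
    exact ha

variable [Algebra F[X] K] [IsScalarTower F F[X] K]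

lemma algebraMap_polynomial_eq_aeval (p : F[X]) :
    algebraMap F[X] K p = aeval (algebraMap F[X] K X) p := by
  rw [aeval_algebraMap_apply, aeval_X_left_apply]

lemma algebraMap_polynomial_mem {O : ValuationSubring K} (hF : ∀ a : F, algebraMap F K a ∈ O)
    (hX : algebraMap F[X] K X ∈ O) (p : F[X]) : algebraMap F[X] K p ∈ O := by
  rw [algebraMap_polynomial_eq_aeval, aeval_eq_sum_range]
  refine sum_mem fun i _ => ?_
  rw [Algebra.smul_def]
  exact mul_mem (hF _) (pow_mem hX _)

/-- Besides `K` itself, the valuation rings containing F[X] are those of the places where X is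
regular. -/
lemma mem_integralClosure_polynomial_iff {a : K} : a ∈ integralClosure F[X] K ↔
    ∀ w : Place F K, algebraMap F[X] K X ∈ w.ring → a ∈ w.ring := by
  rw [mem_integralClosure_iff_valuationSubring]
  constructor
  · exact fun h w hw => h _ (algebraMap_polynomial_mem w.algebraMap_mem hw)
  · intro h O hO
    by_cases hne : O = ⊤
    · rw [hne]; exact ValuationSubring.mem_top a
    · refine h ⟨O, fun r => ?_, hne⟩ (hO X)
      rw [IsScalarTower.algebraMap_apply F F[X] K]
      exact hO _

lemma valuation_algebraMap_polynomial {w : Place F K} (hw : algebraMap F[X] K X ∉ w.ring)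
    {p : F[X]} (hp : p ≠ 0) : w.ring.valuation (algebraMap F[X] K p) =
      w.ring.valuation (algebraMap F[X] K X) ^ p.natDegree := by
  rw [algebraMap_polynomial_eq_aeval]
  refine valuation_aeval_eq_valuation_X_pow_natDegree_of_one_lt_valuation_X _ ?_ hp
  rwa [← not_le, ValuationSubring.valuation_le_one_iff]

/-- A proper rational function has no pole at the poles of the variable. -/
lemma div_mem_of_degree_le {w : Place F K} (hw : algebraMap F[X] K X ∉ w.ring) {p q : F[X]}
    (h : p.natDegree ≤ q.natDegree) :
    algebraMap F[X] K p / algebraMap F[X] K q ∈ w.ring := by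
  by_cases hp : p = 0
  · simp [hp, zero_mem]
  by_cases hq : q = 0
  · simp [hq, zero_mem]
  have h1 : 1 < w.ring.valuation (algebraMap F[X] K X) := by
    rwa [← not_le, ValuationSubring.valuation_le_one_iff]
  rw [← ValuationSubring.valuation_le_one_iff, map_div₀, valuation_algebraMap_polynomial hw hp,
    valuation_algebraMap_polynomial hw hq]
  exact div_le_one_of_le₀ (pow_le_pow_right₀ h1.le h) zero_le

/-- The pole orders of an element integral over `F[X]` at the poles of `X` are bounded. -/
lemma exists_div_pow_mem_of_isIntegral {e : K} (he : IsIntegral F[X] e) :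
    ∃ D : ℕ, ∀ d, D ≤ d → ∀ w : Place F K, algebraMap F[X] K X ∉ w.ring →
      e / algebraMap F[X] K X ^ d ∈ w.ring := by
  obtain ⟨p, hp, hpe⟩ := he
  -- D bounds the degrees of the lower coefficients. If e had a larger value than X ^ d, the leading
  -- term of its monic equation would strictly dominate all others.
  let D := (Finset.range p.natDegree).sup fun k => (p.coeff k).natDegree
  refine ⟨D, fun d hd w hw => ?_⟩
  set y := algebraMap F[X] K X with hy
  set V := w.ring.valuation
  have h1 : 1 < V y := by
    rwa [← not_le, ValuationSubring.valuation_le_one_iff]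
  have h0 : 0 < V y ^ d := pow_pos (zero_lt_one.trans h1) _
  rw [← ValuationSubring.valuation_le_one_iff, map_div₀, map_pow, div_le_one₀ h0]
  by_contra! hlt
  have he1 : 1 < V e := (one_le_pow₀ h1.le).trans_lt hlt
  rw [hp.as_sum, eval₂_add, eval₂_pow, eval₂_X, eval₂_finsetSum] at hpe
  have hsum : V (∑ i ∈ Finset.range p.natDegree,
      eval₂ (algebraMap F[X] K) e (C (p.coeff i) * X ^ i)) < V e ^ p.natDegree := by
    refine V.map_sum_lt (pow_ne_zero _ (zero_lt_one.trans he1).ne') fun i hi => ?_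
    rw [eval₂_mul, eval₂_C, eval₂_pow, eval₂_X, map_mul, map_pow]
    have hc : V (algebraMap F[X] K (p.coeff i)) ≤ V y ^ d := by
      by_cases hz : p.coeff i = 0
      · simp [hz]
      · rw [valuation_algebraMap_polynomial hw hz]
        exact pow_le_pow_right₀ h1.le ((Finset.le_sup (f := fun k => (p.coeff k).natDegree) hi).trans hd)
    calc V (algebraMap F[X] K (p.coeff i)) * V e ^ i
        ≤ V y ^ d * V e ^ i := by gcongr
      _ < V e * V e ^ i := mul_lt_mul_of_pos_right hlt (pow_pos (zero_lt_one.trans he1) _)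
      _ = V e ^ (i + 1) := (pow_succ' _ _).symm
      _ ≤ V e ^ p.natDegree := pow_le_pow_right₀ he1.le (Finset.mem_range.1 hi)
  rw [add_eq_zero_iff_eq_neg] at hpe
  have := congrArg V hpe
  rw [Valuation.map_neg, map_pow] at this
  exact hsum.ne' this

end Polynomial

/-! ### Constructing an element with a single pole -/

section Pole

variable {F K : Type*} [Field F] [Field K]

/-- Division with remainder: a rational function is the sum of a polynomial, a combination of
`X⁻¹, …, X⁻ᵈ`, and `X⁻ᵈ` times a proper rational function. -/
lemma exists_polynomial_add_proper [Algebra F[X] K] [FaithfulSMul F[X] K] (d : ℕ) (n m : F[X])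
    (hm : m ≠ 0) : ∃ (a : F[X]) (r : degreeLT F d) (s : F[X]), s.natDegree ≤ m.natDegree ∧
      algebraMap F[X] K n / algebraMap F[X] K m = algebraMap F[X] K a +
        (algebraMap F[X] K r + algebraMap F[X] K s / algebraMap F[X] K m) /
          algebraMap F[X] K X ^ d := by
  have hinj := FaithfulSMul.algebraMap_injective F[X] K
  have hm0 : algebraMap F[X] K m ≠ 0 := (map_ne_zero_iff _ hinj).2 hm
  have hX0 : algebraMap F[X] K X ≠ 0 := (map_ne_zero_iff _ hinj).2 X_ne_zero
  -- Divide twice: X ^ d * n = m * q + s, then q = X ^ d * a + r.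
  let q := (X ^ d * n) / m
  have h1 : m * q + (X ^ d * n) % m = X ^ d * n := EuclideanDomain.div_add_mod _ _
  have h2 : X ^ d * (q / X ^ d) + q % X ^ d = q := EuclideanDomain.div_add_mod _ _
  refine ⟨q / X ^ d, ⟨q % X ^ d, ?_⟩, (X ^ d * n) % m,
    natDegree_le_natDegree (degree_mod_lt _ hm).le, ?_⟩
  · rw [mem_degreeLT]
    simpa using degree_mod_lt q (pow_ne_zero d (X_ne_zero (R := F)))
  · have h3 := congrArg (algebraMap F[X] K) h1
    have h4 := congrArg (algebraMap F[X] K) h2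
    simp only [map_add, map_mul, map_pow] at h3 h4
    dsimp only
    field_simp
    linear_combination -h3 - algebraMap F[X] K m * h4

variable [Algebra F K] [Algebra F[X] K] [IsScalarTower F F[X] K] [FaithfulSMul F[X] K]
  [Algebra.IsAlgebraic F[X] K] [Algebra.EssFiniteType F K] [Finite F]

/-- Among the differences of the terms of an infinite sequence in `K` there is one that is the sum
of an element integral over `F[X]` and an element without poles at the poles of `X`. -/
lemma exists_sub_eq_add (u : ℕ → K) : ∃ i j, i ≠ j ∧ ∃ b ∈ integralClosure F[X] K, ∃ c : K,
    u i - u j = b + c ∧ ∀ w : Place F K, algebraMap F[X] K X ∉ w.ring → c ∈ w.ring := by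
  let k := FractionRing F[X]
  let : Algebra k K := FractionRing.liftAlgebra F[X] K
  have : IsScalarTower F[X] k K := inferInstance
  have : IsScalarTower F k K := IsScalarTower.of_algebraMap_eq fun x => by
    rw [IsScalarTower.algebraMap_apply F F[X] K, IsScalarTower.algebraMap_apply F[X] k K,
      IsScalarTower.algebraMap_apply F F[X] k]
  have : Algebra.IsAlgebraic k K := (IsFractionRing.comap_isAlgebraic_iff (A := F[X])).1 inferInstance
  have : Algebra.EssFiniteType k K := Algebra.EssFiniteType.of_comp F k K
  have : FiniteDimensional k K := Algebra.finite_of_essFiniteType_of_isAlgebraic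
  obtain ⟨S, e, he⟩ := FiniteDimensional.exists_is_basis_integral F[X] k K
  choose D hD using fun i => exists_div_pow_mem_of_isIntegral (F := F) (he i)
  let d := Finset.univ.sup D
  have hd (i : S) := hD i d (Finset.le_sup (Finset.mem_univ i))
  have hdec (x : k) : ∃ (a : F[X]) (r : degreeLT F d) (g : K),
      algebraMap k K x = algebraMap F[X] K a +
        (algebraMap F[X] K r + g) / algebraMap F[X] K X ^ d ∧
      ∀ w : Place F K, algebraMap F[X] K X ∉ w.ring → g ∈ w.ring := by
    obtain ⟨n, m, hm, rfl⟩ := IsFractionRing.div_surjective (A := F[X]) x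
    obtain ⟨a, r, s, hs, h⟩ := exists_polynomial_add_proper (K := K) d n m (nonZeroDivisors.ne_zero hm)
    refine ⟨a, r, _, ?_, fun w hw => div_mem_of_degree_le hw hs⟩
    rw [map_div₀, ← IsScalarTower.algebraMap_apply, ← IsScalarTower.algebraMap_apply, h]
  choose a r g hg hgw using hdec
  have : Finite (degreeLT F d) := Finite.of_equiv _ (degreeLTEquiv F d).symm.toEquiv
  obtain ⟨i, j, hij, h⟩ := Finite.exists_ne_map_eq_of_infinite
    fun (n : ℕ) (l : S) => r (e.repr (u n) l)
  refine ⟨i, j, hij, ∑ l, algebraMap F[X] K (a (e.repr (u i) l) - a (e.repr (u j) l)) * e l,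
    sum_mem fun l _ => mul_mem (algebraMap_mem _ _) (he l),
    ∑ l, (g (e.repr (u i) l) - g (e.repr (u j) l)) * (e l / algebraMap F[X] K X ^ d), ?_,
    fun w hw => sum_mem fun l _ => mul_mem (sub_mem (hgw _ w hw) (hgw _ w hw)) (hd l w hw)⟩
  conv_lhs => rw [← e.sum_repr (u i), ← e.sum_repr (u j)]
  rw [← Finset.sum_sub_distrib, ← Finset.sum_add_distrib]
  refine Finset.sum_congr rfl fun l _ => ?_
  have hl : r (e.repr (u i) l) = r (e.repr (u j) l) := congrFun h l
  rw [Algebra.smul_def, Algebra.smul_def, hg, hg, hl, map_sub]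
  ring

/-- If the variable has no pole at `v`, some element of `K` has its only pole at `v`. -/
lemma exists_unique_pole (v : Place F K) (hv : algebraMap F[X] K X ∈ v.ring) :
    ∃ t : K, ∀ w : Place F K, t ∈ w.ring ↔ w ≠ v := by
  let B := integralClosure F[X] K
  have : IsDedekindDomain B := integralClosure_polynomial_isDedekindDomain F K
  have : IsFractionRing B K := integralClosure_polynomial_isFractionRing F K
  have hB (w : Place F K) (hw : algebraMap F[X] K X ∈ w.ring) (b : B) : algebraMap B K b ∈ w.ring :=
    mem_integralClosure_polynomial_iff.1 b.2 w hw
  obtain ⟨u, hu, hu'⟩ := exists_pole_of_isDedekindDomain (hB v hv) v.ne_top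
  have huw (w : Place F K) (hw : algebraMap F[X] K X ∈ w.ring) (hwv : w ≠ v) : u ∈ w.ring :=
    hu' w.ring w.ne_top (fun h => hwv (Place.ext_ring h)) (hB w hw)
  have huv : u ∉ v.ring := fun h => hu ⟨⟨u, mem_integralClosure_polynomial_iff.2 fun w hw => by
    by_cases hwv : w = v
    · rwa [hwv]
    · exact huw w hw hwv⟩, rfl⟩
  obtain ⟨i, j, hij, b, hb, c, hbc, hc⟩ := exists_sub_eq_add (F := F) (u ^ ·)
  -- Distinct powers of u have distinct values at v, so the pole survives. As b is regular at v, it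
  -- passes to c.
  have hsub : u ^ i - u ^ j ∉ v.ring := by
    wlog hlt : i < j generalizing i j b c
    · rw [← neg_sub, neg_mem_iff]
      exact this j i hij.symm (-b) (neg_mem hb) (-c) (by rw [← neg_sub, hbc]; ring)
        (fun w hw => neg_mem (hc w hw)) (hij.lt_or_gt.resolve_left hlt)
    rw [← v.ring.valuation_le_one_iff, not_le] at huv ⊢
    rw [Valuation.map_sub_eq_of_lt_right, map_pow]
    · exact one_lt_pow₀ huv (by omega)
    · rw [map_pow, map_pow]
      exact pow_lt_pow_right₀ huv hlt
  have hbw := mem_integralClosure_polynomial_iff.1 hb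
  refine ⟨c, fun w => ⟨?_, fun hwv => ?_⟩⟩
  · rintro h rfl
    exact hsub (by rw [hbc]; exact add_mem (hbw w hv) h)
  · by_cases hw : algebraMap F[X] K X ∈ w.ring
    · rw [eq_sub_iff_add_eq'.2 hbc.symm]
      have := huw w hw hwv
      exact sub_mem (sub_mem (pow_mem this _) (pow_mem this _)) (hbw w hw)
    · exact hc w hw

end Pole

/-! ### The ring A as a Dedekind domain -/

section FunctionField

variable {F K : Type*} [Field F] [Field K] [Algebra F K]

lemma mem_integralOutside {v : Place F K} {a : K} :
    a ∈ integralOutside v ↔ ∀ w : Place F K, w ≠ v → a ∈ w.ring := by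
  simp [integralOutside, Subring.mem_iInf]

lemma essFiniteType_of_functionField [Algebra F⟮X⟯ K] [IsScalarTower F F⟮X⟯ K] [FunctionField F K] :
    Algebra.EssFiniteType F K := by
  have : Algebra.EssFiniteType F[X] F⟮X⟯ := .of_isLocalization _ (nonZeroDivisors F[X])
  have : Algebra.EssFiniteType F F⟮X⟯ := .comp F F[X] F⟮X⟯
  exact .comp F F⟮X⟯ K

/-- The structure of `F[X]`-algebra on `K` in which `X` acts as `t`. -/
@[reducible] noncomputable def polynomialAlgebra (F : Type*) {K : Type*} [Field F] [Field K]
    [Algebra F K] (t : K) : Algebra F[X] K :=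
  (aeval t : F[X] →ₐ[F] K).toRingHom.toAlgebra

lemma polynomialAlgebra_isScalarTower (t : K) :
    letI := polynomialAlgebra F t
    IsScalarTower F F[X] K :=
  letI := polynomialAlgebra F t
  .of_algebraMap_eq fun a => ((aeval t : F[X] →ₐ[F] K).commutes a).symm

lemma polynomialAlgebra_algebraMap_X (t : K) :
    letI := polynomialAlgebra F t
    algebraMap F[X] K X = t :=
  aeval_X t

lemma polynomialAlgebra_faithfulSMul {t : K} (ht : Transcendental F t) :
    letI := polynomialAlgebra F t
    FaithfulSMul F[X] K :=
  letI := polynomialAlgebra F t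
  (faithfulSMul_iff_algebraMap_injective F[X] K).2 (transcendental_iff_injective.1 ht)

/-- K is finite over F(t), hence algebraic over F[t], which is the image of F[X]. -/
lemma polynomialAlgebra_isAlgebraic [Algebra F⟮X⟯ K] [IsScalarTower F F⟮X⟯ K] [FunctionField F K]
    {t : K} (ht : Transcendental F t) :
    letI := polynomialAlgebra F t
    Algebra.IsAlgebraic F[X] K := by
  let := polynomialAlgebra F t
  have := FunctionField.finiteDimensional_of_adjoin_transcendental ht
  refine ⟨fun a => ?_⟩
  have h : IsAlgebraic (Algebra.adjoin F {t}) a :=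
    IntermediateField.isAlgebraic_adjoin_iff.1 (Algebra.IsAlgebraic.isAlgebraic a)
  let f : F[X] →ₐ[F] Algebra.adjoin F {t} :=
    (aeval t).codRestrict _ fun p => aeval_mem_adjoin_singleton F t
  have hf : Function.Surjective f := by
    rintro ⟨x, hx⟩
    obtain ⟨p, hp⟩ := (Algebra.adjoin_singleton_eq_range_aeval F t ▸ hx :)
    exact ⟨p, Subtype.ext hp⟩
  exact h.of_ringHom_of_comp_eq f (RingHom.id K) hf Function.injective_id rfl

variable [Algebra F⟮X⟯ K] [IsScalarTower F F⟮X⟯ K] [FunctionField F K] [Finite F]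

/-- For every place of a function field there is an element whose only pole is that place. -/
theorem Place.exists_unique_pole (v : Place F K) : ∃ t : K, ∀ w : Place F K, t ∈ w.ring ↔ w ≠ v := by
  have hess : Algebra.EssFiniteType F K := essFiniteType_of_functionField
  have hx : Transcendental F (algebraMap F⟮X⟯ K RatFunc.X) :=
    (transcendental_algebraMap_iff (algebraMap F⟮X⟯ K).injective).2 RatFunc.transcendental_X
  have key (y : K) (hy : Transcendental F y) (hv : y ∈ v.ring) :
      ∃ t : K, ∀ w : Place F K, t ∈ w.ring ↔ w ≠ v := by
    let := polynomialAlgebra F y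
    have := polynomialAlgebra_isScalarTower (F := F) y
    have := polynomialAlgebra_faithfulSMul hy
    have := polynomialAlgebra_isAlgebraic hy
    exact DrinfeldModular.exists_unique_pole v
      (by rwa [polynomialAlgebra_algebraMap_X (F := F) y])
  -- Either x or x⁻¹ is regular at v and can serve as the variable.
  rcases v.ring.mem_or_inv_mem (algebraMap F⟮X⟯ K RatFunc.X) with h | h
  · exact key _ hx h
  · exact key _ (fun h' => hx (IsAlgebraic.inv_iff.1 h')) h

/-- `A` is a Dedekind domain with finite class group and field of fractions `K`. -/
theorem integralOutside_isDedekindDomain_and_finite_classGroup (v : Place F K) :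
    IsDedekindDomain (integralOutside v) ∧ IsFractionRing (integralOutside v) K ∧
      Finite (ClassGroup (integralOutside v)) := by
  have hess : Algebra.EssFiniteType F K := essFiniteType_of_functionField
  obtain ⟨t, ht⟩ := v.exists_unique_pole
  have htv : t ∉ v.ring := fun h => (ht v).1 h rfl
  have htr : Transcendental F t := by
    rw [← v.ring.valuation_le_one_iff, not_le] at htv
    exact Valuation.transcendental_of_ne_one (v := v.ring.valuation) F t
      (fun h => by simp [h] at htv) htv.ne'
  let := polynomialAlgebra F t
  have := polynomialAlgebra_isScalarTower (F := F) t
  have := polynomialAlgebra_faithfulSMul htr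
  have := polynomialAlgebra_isAlgebraic htr
  -- The places where t is regular are exactly those other than v.
  have hA : integralOutside v = (integralClosure F[X] K).toSubring := by
    ext a
    rw [mem_integralOutside, Subalgebra.mem_toSubring, mem_integralClosure_polynomial_iff,
      polynomialAlgebra_algebraMap_X (F := F) t]
    simp only [ht]
  rw [hA]
  exact ⟨integralClosure_polynomial_isDedekindDomain F K,
    integralClosure_polynomial_isFractionRing F K,
    integralClosure_polynomial_finite_classGroup F K⟩

end FunctionField

/-! ### Points of the projective line and ideal classes -/

section Orbits

variable {A : Type*} [CommRing A]

section

variable {K : Type*} [Field K] [Algebra A K] [IsFractionRing A K]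

lemma algebraMap_comp_ne_zero {p : Fin 2 → A} (hp : p ≠ 0) : (fun i => algebraMap A K (p i)) ≠ 0 := by
  obtain ⟨k, hk⟩ := Function.ne_iff.1 hp
  exact Function.ne_iff.2 ⟨k, (map_ne_zero_iff _ (IsFractionRing.injective A K)).2 hk⟩

lemma exists_integral_rep [IsDomain A] (P : ℙ K (Fin 2 → K)) : ∃ (p : Fin 2 → A) (hp : p ≠ 0),
    P = .mk K (fun i => algebraMap A K (p i)) (algebraMap_comp_ne_zero hp) := by
  induction P using Projectivization.ind with | _ x hx =>
  obtain ⟨b, hb⟩ := IsLocalization.exist_integer_multiples_of_finite (nonZeroDivisors A) x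
  choose p hp using hb
  have hb0 : algebraMap A K b ≠ 0 :=
    (map_ne_zero_iff _ (IsFractionRing.injective A K)).2 (nonZeroDivisors.ne_zero b.2)
  have hpx (i) : algebraMap A K (p i) = algebraMap A K b * x i := by
    rw [hp, Algebra.smul_def]
  have hp0 : p ≠ 0 := by
    obtain ⟨k, hk⟩ := Function.ne_iff.1 hx
    refine Function.ne_iff.2 ⟨k, fun h => mul_ne_zero hb0 hk ?_⟩
    rw [← hpx, h]; simp
  refine ⟨p, hp0, ((Projectivization.mk_eq_mk_iff' K _ _ _ _).2 ⟨algebraMap A K b, ?_⟩).symm⟩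
  ext i
  simp [hpx]

end

variable [IsDedekindDomain A]

/-- Two vectors whose entries generate the same nonzero ideal are equivalent under `GL₂(A)`. -/
lemma exists_mulVec_eq_of_span_eq {p q : Fin 2 → A} (hp : p ≠ 0)
    (h : Ideal.span {p 0, p 1} = Ideal.span {q 0, q 1}) :
    ∃ g : GL (Fin 2) A, g.1.mulVec p = q := by
  set I := Ideal.span {p 0, p 1} with hI
  have hmem (i : Fin 2) : p i ∈ I := Ideal.subset_span (by fin_cases i <;> simp)
  have hmem' (i : Fin 2) : q i ∈ I := by
    rw [h]; exact Ideal.subset_span (by fin_cases i <;> simp)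
  obtain ⟨k, hk⟩ := Function.ne_iff.1 hp
  obtain ⟨α, hαI, hα⟩ : ∃ α ∈ I, α ≠ 0 := ⟨p k, hmem k, hk⟩
  -- With I * J = (α), choose c, d in J² such that p · c = α = q · d. The matrix sought sends p to q
  -- and (-c₁, c₀) to (-d₁, d₀). Both pairs have determinant α, so it has determinant 1; its entries
  -- are elements of I * J divided by α, hence lie in `A`.
  obtain ⟨J, hJ⟩ := Ideal.dvd_iff_le.2 ((Ideal.span_singleton_le_iff_mem I).2 hαI)
  have hex (x y : A) (hxy : I = Ideal.span {x, y}) : ∃ c ∈ J, ∃ d ∈ J, x * c + y * d = α := by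
    have h1 : α ∈ I * J := by rw [← hJ]; exact Ideal.mem_span_singleton_self α
    rw [hxy, Ideal.span_insert, Ideal.sup_mul, Submodule.mem_sup] at h1
    obtain ⟨a, ha, b, hb, hab⟩ := h1
    obtain ⟨c, hc, rfl⟩ := Ideal.mem_span_singleton_mul.1 ha
    obtain ⟨d, hd, rfl⟩ := Ideal.mem_span_singleton_mul.1 hb
    exact ⟨c, hc, d, hd, hab⟩
  obtain ⟨c₀, hc₀, c₁, hc₁, hc⟩ := hex _ _ hI
  obtain ⟨d₀, hd₀, d₁, hd₁, hd⟩ := hex _ _ h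
  have hdiv {x : A} (hx : x ∈ I * J) : ∃ m, x = α * m := by
    rw [← hJ, Ideal.mem_span_singleton] at hx; exact hx
  obtain ⟨a, ha⟩ := hdiv (add_mem (Ideal.mul_mem_mul (hmem' 0) hc₀) (Ideal.mul_mem_mul (hmem 1) hd₁))
  obtain ⟨b, hb⟩ := hdiv (sub_mem (Ideal.mul_mem_mul (hmem' 0) hc₁) (Ideal.mul_mem_mul (hmem 0) hd₁))
  obtain ⟨c, hc'⟩ := hdiv (sub_mem (Ideal.mul_mem_mul (hmem' 1) hc₀) (Ideal.mul_mem_mul (hmem 1) hd₀))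
  obtain ⟨d, hd'⟩ := hdiv (add_mem (Ideal.mul_mem_mul (hmem' 1) hc₁) (Ideal.mul_mem_mul (hmem 0) hd₀))
  have hdet : a * d - b * c = 1 := by
    have : α ^ 2 * (a * d - b * c) = α ^ 2 * 1 := by
      calc α ^ 2 * (a * d - b * c) = (α * a) * (α * d) - (α * b) * (α * c) := by ring
        _ = (p 0 * c₀ + p 1 * c₁) * (q 0 * d₀ + q 1 * d₁) := by
          rw [← ha, ← hb, ← hc', ← hd']; ring
        _ = α ^ 2 * 1 := by rw [hc, hd]; ring
    exact mul_left_cancel₀ (pow_ne_zero 2 hα) this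
  refine ⟨Matrix.GeneralLinearGroup.mk'' !![a, b; c, d]
    (by rw [Matrix.det_fin_two_of, hdet]; exact isUnit_one), ?_⟩
  change Matrix.mulVec !![a, b; c, d] p = q
  ext i
  fin_cases i
  · simp only [Matrix.mulVec, dotProduct, Fin.sum_univ_two, Fin.zero_eta, Matrix.of_apply,
      Matrix.cons_val', Matrix.cons_val_zero, Matrix.cons_val_one]
    refine mul_left_cancel₀ hα ?_
    linear_combination (-p 0) * ha - p 1 * hb + q 0 * hc
  · simp [Matrix.mulVec, dotProduct, Fin.sum_univ_two]
    refine mul_left_cancel₀ hα ?_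
    linear_combination (-p 0) * hc' - p 1 * hd' + q 1 * hc

variable {K : Type*} [Field K] [Algebra A K] [IsFractionRing A K]

/-- The points of `ℙ¹(K)` fall into classes, indexed by the class group of `A`, such that points
of the same class are equivalent under `GL₂(A)`. -/
theorem exists_classGroup_invariant : ∃ cls : ℙ K (Fin 2 → K) → ClassGroup A,
    ∀ P Q, cls P = cls Q →
      ∃ g : GL (Fin 2) A, Matrix.GeneralLinearGroup.map (algebraMap A K) g • P = Q := by
  classical
  choose p hp hP using exists_integral_rep (A := A) (K := K)
  have hne (P) : Ideal.span {p P 0, p P 1} ∈ nonZeroDivisors (Ideal A) := by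
    rw [mem_nonZeroDivisors_iff_ne_zero]
    intro h
    rw [Ideal.zero_eq_bot, Ideal.span_eq_bot] at h
    refine hp P (funext fun i => h _ ?_)
    fin_cases i <;> simp
  refine ⟨fun P => ClassGroup.mk0 ⟨_, hne P⟩, fun P Q h => ?_⟩
  -- Equal classes mean proportional ideals; rescaling the coordinates makes the ideals equal
  -- without moving the points.
  obtain ⟨x, y, hx, hy, hxy⟩ := ClassGroup.mk0_eq_mk0_iff.1 h
  have hspan (z a b : A) : Ideal.span {z} * Ideal.span {a, b} = Ideal.span {z * a, z * b} := by
    rw [Ideal.span_mul_span', Set.singleton_mul, Set.image_pair]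
  simp only [hspan] at hxy
  obtain ⟨g, hg⟩ := exists_mulVec_eq_of_span_eq (p := x • p P) (q := y • p Q)
    (smul_ne_zero hx (hp P)) hxy
  refine ⟨g, ?_⟩
  have hinj := IsFractionRing.injective A K
  have hx' := (map_ne_zero_iff _ hinj).2 hx
  have hy' := (map_ne_zero_iff _ hinj).2 hy
  rw [hP P, hP Q, Projectivization.smul_mk, Projectivization.mk_eq_mk_iff']
  refine ⟨algebraMap A K y / algebraMap A K x, ?_⟩
  rw [div_eq_inv_mul, mul_smul, inv_smul_eq_iff₀ hx']
  ext i
  have hgi := congrArg (algebraMap A K) (congrFun hg i)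
  simp only [Matrix.mulVec, dotProduct, Fin.sum_univ_two, Pi.smul_apply, smul_eq_mul, map_add, map_mul] at hgi
  change algebraMap A K y * algebraMap A K (p Q i) = algebraMap A K x *
    (Matrix.mulVec (g.1.map (algebraMap A K)) (fun i => algebraMap A K (p P i))) i
  rw [← hgi]
  simp only [Matrix.mulVec, dotProduct, Fin.sum_univ_two, Matrix.map_apply]
  ring

end Orbits

/-! ### Permutations of points induced by automorphisms -/

section Abstract

variable {G X : Type*} [Group G] [MulAction G X]

/-- Let `T` be a set of elements of `G` with exactly one fixed point each, such that every point is
fixed by an element of `T` and elements of `T` with the same fixed point commute. An automorphism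
of `G` that preserves `T` induces a compatible permutation of the points. -/
lemma exists_equiv_of_unique_fixedPoint (T : Set G) (hex : ∀ g ∈ T, ∃ x : X, g • x = x)
    (huniq : ∀ g ∈ T, ∀ x y : X, g • x = x → g • y = y → x = y)
    (hsurj : ∀ x : X, ∃ g ∈ T, g • x = x)
    (hcomm : ∀ g ∈ T, ∀ h ∈ T, ∀ x : X, g • x = x → h • x = x → Commute g h)
    (hconj : ∀ g ∈ T, ∀ k : G, k * g * k⁻¹ ∈ T)
    (σ : MulAut G) (hσ : ∀ g, σ g ∈ T ↔ g ∈ T) :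
    ∃ e : X ≃ X, ∀ (g : G) (x : X), e (g • x) = σ g • e x := by
  have key (τ : MulAut G) (hτ : ∀ g, τ g ∈ T ↔ g ∈ T) :
      ∃ φ : X → X, ∀ g ∈ T, ∀ x, g • x = x → τ g • φ x = φ x := by
    choose g hg hgx using hsurj
    choose φ hφ using fun x => hex (τ (g x)) ((hτ _).2 (hg x))
    refine ⟨φ, fun h hh x hhx => ?_⟩
    have hc : τ (g x) * τ h = τ h * τ (g x) :=
      (hcomm _ (hg x) _ hh x (hgx x) hhx).map τ
    refine huniq _ ((hτ _).2 (hg x)) _ _ ?_ (hφ x)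
    -- By commutation τ h moves the fixed point of τ (g x) to a fixed point of τ (g x), that is, to
    -- itself. So φ x does not depend on the choice of g x.
    rw [← mul_smul, hc, mul_smul, hφ]
  obtain ⟨φ, hφ⟩ := key σ hσ
  have hσ' (g : G) : σ⁻¹ g ∈ T ↔ g ∈ T := by
    rw [← hσ, MulAut.apply_inv_self]
  obtain ⟨ψ, hψ⟩ := key σ⁻¹ hσ'
  refine ⟨⟨φ, ψ, fun x => ?_, fun x => ?_⟩, fun k x => ?_⟩
  · obtain ⟨g, hg, hgx⟩ := hsurj x
    have := hψ _ ((hσ g).2 hg) _ (hφ g hg x hgx)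
    rw [MulAut.inv_apply_self] at this
    exact huniq g hg _ _ this hgx
  · obtain ⟨g, hg, hgx⟩ := hsurj x
    have := hφ _ ((hσ' g).2 hg) _ (hψ g hg x hgx)
    rw [MulAut.apply_inv_self] at this
    exact huniq g hg _ _ this hgx
  · obtain ⟨g, hg, hgx⟩ := hsurj x
    change φ (k • x) = σ k • φ x
    -- As k * g * k⁻¹ fixes k • x, its image under σ fixes both φ (k • x) and σ k • φ x.
    refine huniq (σ (k * g * k⁻¹)) ((hσ _).2 (hconj g hg k)) _ _ (hφ _ (hconj g hg k) _ ?_) ?_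
    · rw [mul_smul, mul_smul, inv_smul_smul, hgx]
    · rw [map_mul, map_mul, map_inv, mul_smul, mul_smul, inv_smul_smul, hφ g hg x hgx]

end Abstract

/-! ### Unipotent elements and their fixed points -/

section Nilpotent

variable {K : Type*} [Field K]

/-- Cayley–Hamilton: trace and determinant both vanish. -/
lemma sq_eq_zero_of_isNilpotent {N : Matrix (Fin 2) (Fin 2) K} (hN : IsNilpotent N) :
    N * N = 0 := by
  have htr : N.trace = 0 := (Matrix.isNilpotent_trace_of_isNilpotent hN).eq_zero
  have hdet : N.det = 0 := by
    obtain ⟨n, hn⟩ := hN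
    have h := congrArg Matrix.det hn
    rw [Matrix.det_pow, Matrix.det_zero] at h
    exact eq_zero_of_pow_eq_zero h
  rw [Matrix.trace_fin_two] at htr
  rw [Matrix.det_fin_two] at hdet
  ext i j
  fin_cases i <;> fin_cases j <;> simp [Matrix.mul_apply, Fin.sum_univ_two]
  · linear_combination N 0 0 * htr - hdet
  · linear_combination N 0 1 * htr
  · linear_combination N 1 0 * htr
  · linear_combination N 1 1 * htr - hdet

lemma exists_smul_eq_of_mulVec_eq_zero {N : Matrix (Fin 2) (Fin 2) K} (hN : N ≠ 0)
    {x y : Fin 2 → K} (hx : x ≠ 0) (hNx : N.mulVec x = 0) (hNy : N.mulVec y = 0) :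
    ∃ c : K, c • x = y := by
  have hxi (i : Fin 2) : N i 0 * x 0 + N i 1 * x 1 = 0 := by
    simpa [Matrix.mulVec, dotProduct, Fin.sum_univ_two] using congrFun hNx i
  have hyi (i : Fin 2) : N i 0 * y 0 + N i 1 * y 1 = 0 := by
    simpa [Matrix.mulVec, dotProduct, Fin.sum_univ_two] using congrFun hNy i
  have hdet : x 0 * y 1 - x 1 * y 0 = 0 := by
    by_contra hne
    refine hN (Matrix.ext fun i j => ?_)
    refine (mul_eq_zero.1 (?_ : (x 0 * y 1 - x 1 * y 0) * N i j = 0)).resolve_left hne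
    fin_cases j
    · change (x 0 * y 1 - x 1 * y 0) * N i 0 = 0
      linear_combination y 1 * hxi i - x 1 * hyi i
    · change (x 0 * y 1 - x 1 * y 0) * N i 1 = 0
      linear_combination x 0 * hyi i - y 0 * hxi i
  by_cases h0 : x 0 = 0
  · have h1 : x 1 ≠ 0 := fun h1 => hx (by ext i; fin_cases i <;> simp [h0, h1])
    refine ⟨y 1 / x 1, ?_⟩
    ext i
    fin_cases i
    · have : y 0 = 0 := by simpa [h0, h1] using hdet
      simp [h0, this]
    · simp [h1]
  · refine ⟨y 0 / x 0, ?_⟩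
    ext i
    fin_cases i
    · simp [h0]
    · simp only [Fin.mk_one, Pi.smul_apply, smul_eq_mul]
      field_simp
      linear_combination -hdet

/-- The image of `N'` lies in its kernel, the line through x, which `N` kills. By symmetry this
yields commutation of unipotents with a common fixed point. -/
lemma mul_eq_zero_of_mulVec_eq_zero {N N' : Matrix (Fin 2) (Fin 2) K} (hN' : N' * N' = 0)
    (hN'0 : N' ≠ 0) {x : Fin 2 → K} (hx : x ≠ 0) (hNx : N.mulVec x = 0) (hN'x : N'.mulVec x = 0) :
    N * N' = 0 := by
  refine Matrix.ext_of_mulVec_single fun i => ?_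
  obtain ⟨c, hc⟩ := exists_smul_eq_of_mulVec_eq_zero hN'0 hx hN'x
    (y := N'.mulVec (Pi.single i 1)) (by rw [Matrix.mulVec_mulVec, hN', Matrix.zero_mulVec])
  rw [← Matrix.mulVec_mulVec, ← hc, Matrix.mulVec_smul, hNx, smul_zero, Matrix.zero_mulVec]

/-- The fixed points of a unipotent element. -/
lemma smul_mk_eq_iff {M : GL (Fin 2) K} (hM : (M.1 - 1) * (M.1 - 1) = 0) {x : Fin 2 → K}
    (hx : x ≠ 0) : M • Projectivization.mk K x hx = Projectivization.mk K x hx ↔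
      (M.1 - 1).mulVec x = 0 := by
  rw [Projectivization.smul_mk, Projectivization.mk_eq_mk_iff']
  change (∃ c : K, c • x = M.1.mulVec x) ↔ _
  rw [Matrix.sub_mulVec, Matrix.one_mulVec, sub_eq_zero]
  refine ⟨?_, fun h => ⟨1, by rw [h, one_smul]⟩⟩
  rintro ⟨c, hc⟩
  have h1 : (M.1 - 1).mulVec x = (c - 1) • x := by
    rw [Matrix.sub_mulVec, Matrix.one_mulVec, ← hc, sub_smul, one_smul]
  -- An eigenvalue c of M satisfies (c - 1)² = 0, so a fixed line is fixed pointwise.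
  have h2 : ((c - 1) * (c - 1)) • x = 0 := by
    rw [mul_smul, ← h1, ← Matrix.mulVec_smul, ← h1, Matrix.mulVec_mulVec, hM, Matrix.zero_mulVec]
  have h3 : c - 1 = 0 := mul_self_eq_zero.1 ((smul_eq_zero.1 h2).resolve_right hx)
  rw [← hc, sub_eq_zero.1 h3, one_smul]

end Nilpotent

section GL2

variable {A K : Type*} [CommRing A] [Field K] [Algebra A K] [IsFractionRing A K]

lemma GL_map_injective :
    Function.Injective (Matrix.GeneralLinearGroup.map (n := Fin 2) (algebraMap A K)) := by
  intro g h hgh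
  refine Units.ext (Matrix.ext fun i j => IsFractionRing.injective A K ?_)
  have h : g.1.map (algebraMap A K) = h.1.map (algebraMap A K) := congrArg Units.val hgh
  exact congrFun (congrFun h i) j

/-- In characteristic p, (M - 1) ^ p = M ^ p - 1 = 0. -/
lemma sub_one_mul_self_eq_zero (p : ℕ) [hp : Fact p.Prime] [CharP K p]
    {M : GL (Fin 2) K} (hM : M ^ p = 1) :
    (M.1 - 1) * (M.1 - 1) = 0 := by
  refine sq_eq_zero_of_isNilpotent ⟨p, ?_⟩
  have h : M.1 ^ p = 1 := congrArg Units.val hM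
  rw [sub_pow_char_of_commute _ (Commute.one_right _), h, one_pow, sub_self]

lemma exists_unipotent (p : ℕ) [hp : Fact p.Prime] [CharP K p]
    (P : ℙ K (Fin 2 → K)) : ∃ g : GL (Fin 2) A, (g ≠ 1 ∧ g ^ p = 1) ∧
    Matrix.GeneralLinearGroup.map (algebraMap A K) g • P = P := by
  have hinj := IsFractionRing.injective A K
  have : IsDomain A := hinj.isDomain
  have : CharP A p := (algebraMap A K).charP hinj p
  obtain ⟨x, hx, rfl⟩ := exists_integral_rep (A := A) P
  -- N is the column x times the row (-x₁, x₀), which annihilates x. Hence N x = 0 and N² = 0.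
  let N : Matrix (Fin 2) (Fin 2) A := !![-(x 0 * x 1), x 0 * x 0; -(x 1 * x 1), x 0 * x 1]
  have hdet : (1 + N).det = 1 := by
    rw [Matrix.det_fin_two]
    simp [N]
    ring
  have hN2 : N ^ 2 = 0 := by
    rw [sq]
    ext i j
    fin_cases i <;> fin_cases j <;> simp [N] <;> ring
  have hN : N ≠ 0 := by
    intro h
    have h0 : x 0 * x 0 = 0 := congrFun (congrFun h 0) 1
    have h1 : -(x 1 * x 1) = 0 := congrFun (congrFun h 1) 0
    rw [neg_eq_zero, mul_self_eq_zero] at h1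
    rw [mul_self_eq_zero] at h0
    exact hx (by ext i; fin_cases i <;> simp [h0, h1])
  refine ⟨Matrix.GeneralLinearGroup.mk'' (1 + N) (by rw [hdet]; exact isUnit_one),
    ⟨fun h => hN ?_, Units.ext ?_⟩, ?_⟩
  · simpa using congrArg Units.val h
  · change (1 + N) ^ p = 1
    rw [add_pow_char_of_commute _ (Commute.one_left _), one_pow,
      pow_eq_zero_of_le hp.out.two_le hN2, add_zero]
  · rw [Projectivization.smul_mk]
    congr 1
    change Matrix.mulVec ((1 + N).map (algebraMap A K)) _ = _
    ext i
    fin_cases i <;>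
      simp [N, Matrix.mulVec, dotProduct, Fin.sum_univ_two] <;> ring


/-- An automorphism of `GL₂(A)` induces a compatible permutation of the points of `ℙ¹(K)`. -/
theorem exists_equiv_projectiveLine (p : ℕ) [hp : Fact p.Prime] [CharP K p]
    (σ : MulAut (GL (Fin 2) A)) :
    ∃ e : ℙ K (Fin 2 → K) ≃ ℙ K (Fin 2 → K), ∀ g x,
      e (Matrix.GeneralLinearGroup.map (algebraMap A K) g • x) =
        Matrix.GeneralLinearGroup.map (algebraMap A K) (σ g) • e x := by
  let f := Matrix.GeneralLinearGroup.map (n := Fin 2) (algebraMap A K)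
  let : MulAction (GL (Fin 2) A) (ℙ K (Fin 2 → K)) := MulAction.compHom _ f
  have hinj : Function.Injective f := GL_map_injective
  -- The elements of order p, a purely group-theoretic description, hence stable under σ.
  let T : Set (GL (Fin 2) A) := {g | g ≠ 1 ∧ g ^ p = 1}
  have hne {g} (hg : g ∈ T) : (f g).1 - 1 ≠ 0 := fun h =>
    hg.1 (hinj (by rw [map_one]; exact Units.ext (sub_eq_zero.1 h)))
  have hsq {g} (hg : g ∈ T) : ((f g).1 - 1) * ((f g).1 - 1) = 0 :=
    sub_one_mul_self_eq_zero p (by rw [← map_pow, hg.2, map_one])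
  have hfix {g} (hg : g ∈ T) {x : Fin 2 → K} (hx : x ≠ 0) :
      g • Projectivization.mk K x hx = .mk K x hx ↔ ((f g).1 - 1).mulVec x = 0 :=
    smul_mk_eq_iff (hsq hg) hx
  have hcomm' {g h} (hg : g ∈ T) (hh : h ∈ T) {x : Fin 2 → K} (hx : x ≠ 0)
      (hgx : g • Projectivization.mk K x hx = .mk K x hx)
      (hhx : h • Projectivization.mk K x hx = .mk K x hx) :
      ((f g).1 - 1) * ((f h).1 - 1) = 0 :=
    mul_eq_zero_of_mulVec_eq_zero (hsq hh) (hne hh) hx ((hfix hg hx).1 hgx) ((hfix hh hx).1 hhx)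
  refine exists_equiv_of_unique_fixedPoint T (fun g hg => ?_) (fun g hg P Q hP hQ => ?_)
    (fun P => ?_) (fun g hg h hh P hgP hhP => ?_) (fun g hg k => ⟨fun h => hg.1 ?_, ?_⟩) σ
    (fun g => ?_)
  · obtain ⟨i, hi⟩ : ∃ i, ((f g).1 - 1).mulVec (Pi.single i 1) ≠ 0 := by
      by_contra! h
      exact hne hg (Matrix.ext_of_mulVec_single fun i => by rw [h, Matrix.zero_mulVec])
    exact ⟨.mk K _ hi, (hfix hg hi).2 (by rw [Matrix.mulVec_mulVec, hsq hg, Matrix.zero_mulVec])⟩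
  · induction P using Projectivization.ind with | _ x hx =>
    induction Q using Projectivization.ind with | _ y hy =>
    obtain ⟨c, hc⟩ := exists_smul_eq_of_mulVec_eq_zero (hne hg) hy ((hfix hg hy).1 hQ)
      ((hfix hg hx).1 hP)
    exact (Projectivization.mk_eq_mk_iff' ..).2 ⟨c, hc⟩
  · obtain ⟨g, hg, h1⟩ := exists_unipotent (A := A) p P
    exact ⟨g, hg, h1⟩
  · induction P using Projectivization.ind with | _ x hx =>
    have h1 := hcomm' hg hh hx hgP hhP
    have h2 := hcomm' hh hg hx hhP hgP
    refine hinj (Units.ext ?_)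
    rw [map_mul, map_mul, Units.val_mul, Units.val_mul]
    rw [sub_mul, mul_sub, mul_sub, mul_one, one_mul] at h1 h2
    have h3 := h1.trans h2.symm
    have h4 : (f g).1 * (f h).1 - (f h).1 * (f g).1 = 0 := by
      rw [← sub_eq_zero] at h3
      rw [← h3]
      abel
    exact sub_eq_zero.1 h4
  · rwa [conj_eq_one_iff] at h
  · rw [conj_pow, hg.2, mul_one, mul_inv_cancel]
  · change (σ g ≠ 1 ∧ σ g ^ p = 1) ↔ (g ≠ 1 ∧ g ^ p = 1)
    rw [← map_pow, Ne, EmbeddingLike.map_eq_one_iff, EmbeddingLike.map_eq_one_iff]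

end GL2

/-! ### Finiteness of the cusps and the main theorem -/

/-- The orbits of the image of a subgroup are its orbits for the action by restriction. -/
lemma orbitRel_map_eq {G L X : Type*} [Group G] [Group L] [MulAction L X] (f : G →* L)
    (H : Subgroup G) : letI := MulAction.compHom X f
      MulAction.orbitRel (H.map f) X = MulAction.orbitRel H X := by
  let := MulAction.compHom X f
  ext x y
  rw [MulAction.orbitRel_apply, MulAction.orbitRel_apply]
  constructor
  · rintro ⟨⟨_, h, hh, rfl⟩, hxy⟩
    exact ⟨⟨h, hh⟩, hxy⟩
  · rintro ⟨⟨h, hh⟩, hxy⟩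
    exact ⟨⟨f h, h, hh, rfl⟩, hxy⟩

lemma finite_orbitRel_quotient_map {G L X : Type*} [Group G] [Group L] [MulAction L X]
    (f : G →* L) {C : Type*} [Finite C] (cls : X → C)
    (hcls : ∀ x y, cls x = cls y → ∃ g : G, f g • x = y) (H : Subgroup G) (hH : H.FiniteIndex) :
    Finite (MulAction.orbitRel.Quotient (H.map f) X) := by
  let := MulAction.compHom X f
  have : Finite (MulAction.orbitRel.Quotient G X) := by
    refine Finite.of_injective (fun q => cls q.out) fun q q' h => ?_
    obtain ⟨g, hg⟩ := hcls _ _ h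
    rw [← q.out_eq, ← q'.out_eq]
    exact (Quotient.sound (s := MulAction.orbitRel G X) ⟨g, hg⟩).symm
  have h : Finite (MulAction.orbitRel.Quotient H X) :=
    H.finite_quotient_of_finite_quotient_of_index_ne_zero hH.index_ne_zero
  unfold MulAction.orbitRel.Quotient
  rw [orbitRel_map_eq f H]
  exact h

end DrinfeldModular

theorem mainTheorem4 {F K : Type*} [Field F] [Finite F] [Field K] [Algebra F K]
    [Algebra F⟮X⟯ K] [IsScalarTower F F⟮X⟯ K] [FunctionField F K]
    (hconst : algebraicClosure F K = ⊥)
    (v : DrinfeldModular.Place F K)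
    (σ : MulAut (DrinfeldModular.ModularGroup v))
    (H : Subgroup (DrinfeldModular.ModularGroup v)) (hH : H.FiniteIndex) :
    Finite (DrinfeldModular.Cusp H) ∧
      DrinfeldModular.cuspNumber (H.map σ.toMonoidHom) = DrinfeldModular.cuspNumber H := by
  obtain ⟨hded, hfrac, hfin⟩ :=
    DrinfeldModular.integralOutside_isDedekindDomain_and_finite_classGroup v
  constructor
  · obtain ⟨cls, hcls⟩ := DrinfeldModular.exists_classGroup_invariant
      (A := DrinfeldModular.integralOutside v) (K := K)
    exact DrinfeldModular.finite_orbitRel_quotient_map (DrinfeldModular.toGLK v) cls hcls H hH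
  · obtain ⟨p, hp⟩ := CharP.exists F
    have hprime : Fact p.Prime := ⟨(CharP.char_is_prime_or_zero F p).resolve_right
      (CharP.char_ne_zero_of_finite F p)⟩
    have : CharP K p := charP_of_injective_algebraMap (algebraMap F K).injective p
    obtain ⟨e, he⟩ := DrinfeldModular.exists_equiv_projectiveLine
      (A := DrinfeldModular.integralOutside v) (K := K) p σ
    -- The bijection e descends to the cusps of H and of σ(H).
    refine (Nat.card_congr (Quotient.congr e fun P Q => ?_)).symm
    change P ∈ MulAction.orbit _ Q ↔ e P ∈ MulAction.orbit _ (e Q)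
    constructor
    · rintro ⟨⟨_, h, hh, rfl⟩, rfl⟩
      exact ⟨⟨_, σ h, ⟨h, hh, rfl⟩, rfl⟩, (he h Q).symm⟩
    · rintro ⟨⟨_, _, ⟨h, hh, rfl⟩, rfl⟩, hPQ⟩
      exact ⟨⟨_, h, hh, rfl⟩, e.injective ((he h Q).trans hPQ)⟩
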